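/- Let $N\ge 0$ be an integer, let $0\le\mu<L$ and $R_x\ge 0$ be real numbers, and for $d\ge1$ let $\mathcal F^{\mu,L}_{R_x}(\mathbb R^d)$ be the set of all problem instances $(\mathcal O_f,x_0)$, where $x_0\in\mathbb R^d$, $f:\mathbb R^d\to\mathbb R$ is $\mu$-strongly convex (i.e. $f-\frac{\mu}{2}\|\cdot\|^2$ is convex; for $\mu=0$, $f$ is convex) and continuously differentiable with $L$-Lipschitz gradient, the set $X_*(f)$ of minimizers of $f$ contains a point $x_*$ with $\|x_*-x_0\|\le R_x$, and $\mathcal O_f:y\mapsto(f(y),\nabla f(y))$ is the first-order oracle of $f$; $\|\cdot\|$ is the Euclidean norm. Let $\mathcal A_N$ be the set of all deterministic first-order methods that perform at most $N$ oracle calls: such a method is given $x_0$, chooses each query point as a function of $x_0$ and the previous oracle answers, and finally returns a point $A(\mathcal O_f,x_0)\in\mathbb R^d$ that depends on $x_0$ and the answers only. For a set $\mathcal I$ of problem instances define, with values in $[0,\infty]$ when $\mathcal I\neq\emptyset$, the minimax risk and the minimax error $$\mathcal R_{\mathcal I}(N):=\inf_{A\in\mathcal A_N}\ \sup_{(\mathcal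 O_f,x_0)\in\mathcal I}\bigl(f(A(\mathcal O_f,x_0))-\inf f\bigr),\qquad \mathcal E_{\mathcal I}(N):=\inf_{A\in\mathcal A_N}\ \sup_{(\mathcal O_f,x_0)\in\mathcal I}\ \inf_{x_*\in X_*(f)}\|A(\mathcal O_f,x_0)-x_*\|.$$ Suppose that the real numbers $\gamma_0,\dots,\gamma_N$ and $\delta_0,\dots,\delta_N$ satisfy $$0\le\tfrac{\mu}{L}\delta_i\le\gamma_i\le\delta_i\quad(0\le i\le N),\qquad \gamma_{i+1}\delta_{i+1}\le-(\gamma_i-\delta_i)\bigl(\gamma_i-\tfrac{\mu}{L}\delta_i\bigr)\quad(0\le i\le N-1),\qquad \sum_{t=0}^N\delta_t^2\le R_x^2 .$$ Then, for $\mathcal I=\mathcal F^{\mu,L}_{R_x}(\mathbb R^{2N+1})$, $$\mathcal R_{\mathcal I}(N)\ \ge\ \frac{L^2}{2(L-\mu)}\Bigl(2\gamma_N\delta_N-\gamma_N^2-\frac{\mu}{L}\delta_N^2\Bigr),$$ and if moreover $\mu>0$, then $\mathcal E_{\mathcal I}(N)\ge\delta_N$. -/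

import Mathlib

namespace OracleComplexity

open scoped Gradient

/-- A deterministic first-order procedure on `E` that makes at most `n` calls to its oracle:
it either stops and returns a point, or (if a call is still available) queries the oracle at
a point and continues in a way that depends on the answer, a function value and a gradient. -/
inductive Procedure (E : Type) : ℕ → Type
  | output {n : ℕ} (ξ : E) : Procedure E n
  | query {n : ℕ} (y : E) (next : ℝ × E → Procedure E n) : Procedure E (n + 1)

/-- The point returned by a procedure when its calls are answered by the oracle `O`. -/
def Procedure.run {E : Type} (O : E → ℝ × E) {n : ℕ} (P : Procedure E n) : E :=
  match P with
  | .output ξ => ξ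
  | .query y next => (next (O y)).run O
termination_by structural P

/-- A deterministic first-order method with at most `N` oracle calls: it is given the starting
point, and then follows a procedure that may depend on this point. -/
abbrev Method (E : Type) (N : ℕ) : Type := E → Procedure E N

section

variable {E : Type} [NormedAddCommGroup E] [InnerProductSpace ℝ E] [CompleteSpace E]

/-- The first-order oracle of `f`. -/
noncomputable def oracle (f : E → ℝ) (x : E) : ℝ × E := (f x, ∇ f x)

/-- The approximate solution generated by the method `A` for the function `f` and the starting
point `x₀`. -/
noncomputable def Method.result {N : ℕ} (A : Method E N) (f : E → ℝ) (x₀ : E) : E :=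
  (A x₀).run (oracle f)

/-- The set of minimizers of `f` over the whole space. -/
def minimizers (f : E → ℝ) : Set E := {x | ∀ y, f x ≤ f y}

/-- Continuously differentiable functions with `L`-Lipschitz gradient. -/
def IsSmoothWith (L : ℝ) (f : E → ℝ) : Prop :=
  ContDiff ℝ 1 f ∧ ∀ x y, ‖∇ f x - ∇ f y‖ ≤ L * ‖x - y‖

variable (E) in
/-- Problem instances `(f, x₀)`: `f` is `μ`-strongly convex with `L`-Lipschitz gradient, and `x₀`
is within distance `R` of some minimizer of `f`. -/
def instances (μ L R : ℝ) : Set ((E → ℝ) × E) :=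
  {p | StrongConvexOn Set.univ μ p.1 ∧ IsSmoothWith L p.1 ∧
    ∃ xs ∈ minimizers p.1, ‖xs - p.2‖ ≤ R}

/-- Worst-case absolute inaccuracy of the method `A` over the instances in `I`; possibly `⊤`. -/
noncomputable def worstRisk {N : ℕ} (A : Method E N) (I : Set ((E → ℝ) × E)) : EReal :=
  ⨆ p ∈ I, ((p.1 (A.result p.1 p.2) - ⨅ y, p.1 y : ℝ) : EReal)

/-- Worst-case distance to the solution set of the method `A` over the instances in `I`;
possibly `⊤`. -/
noncomputable def worstError {N : ℕ} (A : Method E N) (I : Set ((E → ℝ) × E)) : EReal :=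
  ⨆ p ∈ I, ⨅ xs ∈ minimizers p.1, ((‖A.result p.1 p.2 - xs‖ : ℝ) : EReal)

/-- The minimax risk over `I` for methods with at most `N` oracle calls. -/
noncomputable def minimaxRisk (I : Set ((E → ℝ) × E)) (N : ℕ) : EReal :=
  ⨅ A : Method E N, worstRisk A I

/-- The minimax error over `I` for methods with at most `N` oracle calls. -/
noncomputable def minimaxError (I : Set ((E → ℝ) × E)) (N : ℕ) : EReal :=
  ⨅ A : Method E N, worstError A I

end

end OracleComplexity

/-!
For every method an instance with `x₀ = 0` is built on which the method does badly. Put `κ = μ / L`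
and, for orthonormal directions `v 0, …, v N`, consider the affine functions with slopes
`L • (γ i • v i + κ • ∑ t < i, δ t • v t)` for `i ≤ N + 1`, where `γ (N + 1) = 0`. The hard function
is `μ / 2 * ‖·‖²` plus the Moreau envelope, with parameter `L - μ`, of the maximum of these affine
functions. It is `μ`-strongly convex with `L`-Lipschitz gradient, and `-∑ t ≤ N, δ t • v t` is a
minimizer, with value `0` (`isActive_hardMin`, `hardFn_ge`). The envelope is handled in
its dual form, a maximum over convex combinations of the pieces; the first-order optimality condition
`IsActive` of that maximization yields the value, the gradient and its cocoercivity.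

The recursion for `γ` and `δ` makes the function a zero chain (`IsActive.pieces_extend`): at a
point orthogonal to `v k, …, v N`, the pieces with index greater than `k` are inactive, so the oracle
answer involves only `v 0, …, v k`. Hence the directions can be chosen during the run of the
method (`exists_resisting`): `v k` is taken orthogonal to the earlier directions and to the
first `k + 1` queries, and `v N` orthogonal to the earlier directions and to all queries, with its
sign chosen so that the output `ξ` satisfies `0 ≤ ⟪v N, ξ⟫`. That sign is what lets dimension
`2 * N + 1` suffice. On this half-space the distance to the minimizer is at least `δ N`, and the
`N`-th piece alone bounds the function from below by the claimed risk (`hardFn_ge_of_inner_nonneg`).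
-/

namespace OracleComplexity

open scoped Gradient

/-! ### Smoothed maxima of affine functions -/

section SmoothedMaximum

variable {E : Type} [NormedAddCommGroup E] [InnerProductSpace ℝ E]

/-- The affine function `y ↦ ⟪b.1, y⟫ + b.2` lowered by `‖b.1‖² / (2 * M)`: the term that the
pair `b` contributes to the Moreau envelope with parameter `M`. -/
noncomputable def envelopeTerm (M : ℝ) (b : E × ℝ) (y : E) : ℝ :=
  inner ℝ b.1 y + b.2 - ‖b.1‖ ^ 2 / (2 * M)

/-- The Moreau envelope with parameter `M` of the maximum of the affine functions
`y ↦ ⟪b.1, y⟫ + b.2` with `b ∈ C`, written in dual form. The set `C` of pairs (slope, intercept)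
is meant to be compact, convex and nonempty; otherwise the supremum may be a junk value. -/
noncomputable def smoothedMax (M : ℝ) (C : Set (E × ℝ)) (y : E) : ℝ :=
  sSup ((fun b => envelopeTerm M b y) '' C)

/-- The pair `q ∈ C` is maximal among the affine functions of `C` at the proximal point
`y - M⁻¹ • q.1`. This is the first-order optimality condition for `q` to attain the supremum in
`smoothedMax M C y`. -/
def IsActive (M : ℝ) (C : Set (E × ℝ)) (y : E) (q : E × ℝ) : Prop :=
  q ∈ C ∧ ∀ b ∈ C, inner ℝ b.1 (y - M⁻¹ • q.1) + b.2 ≤ inner ℝ q.1 (y - M⁻¹ • q.1) + q.2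

/-- The sum of a quadratic and a smoothed maximum: `μ`-strongly convex with an
`(μ + M)`-Lipschitz gradient. -/
noncomputable def smoothedFn (μ M : ℝ) (C : Set (E × ℝ)) (y : E) : ℝ :=
  μ / 2 * ‖y‖ ^ 2 + smoothedMax M C y

variable {μ M : ℝ} {C : Set (E × ℝ)} {y z : E} {q : E × ℝ}

lemma exists_isActive (hM : 0 < M) (hC : IsCompact C) (hconv : Convex ℝ C) (hne : C.Nonempty)
    (y : E) : ∃ q, IsActive M C y q := by
  have hcont : ContinuousOn (fun b : E × ℝ => envelopeTerm M b y) C := by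
    unfold envelopeTerm
    fun_prop
  obtain ⟨q, hq, hmax⟩ := hC.exists_isMaxOn hne hcont
  refine ⟨q, hq, fun b hb => ?_⟩
  set K : ℝ := inner ℝ (b.1 - q.1) y + (b.2 - q.2) - inner ℝ q.1 (b.1 - q.1) / M with hK
  have hgoal : K ≤ 0 → inner ℝ b.1 (y - M⁻¹ • q.1) + b.2 ≤
      inner ℝ q.1 (y - M⁻¹ • q.1) + q.2 := by
    intro h
    rw [hK, inner_sub_left, inner_sub_right, real_inner_comm b.1 q.1] at h
    simp only [inner_sub_right, inner_smul_right]
    have : (inner ℝ b.1 q.1 - inner ℝ q.1 q.1) / M =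
      M⁻¹ * inner ℝ b.1 q.1 - M⁻¹ * inner ℝ q.1 q.1 := by ring
    linarith
  apply hgoal
  -- The derivative of the objective along the segment from `q` to `b` is nonpositive.
  have hseg : ∀ t : ℝ, 0 < t → t ≤ 1 → K ≤ t * (‖b.1 - q.1‖ ^ 2 / (2 * M)) := by
    intro t ht ht1
    have hmem : q + t • (b - q) ∈ C := hconv.add_smul_sub_mem hq hb ⟨ht.le, ht1⟩
    have h : envelopeTerm M (q + t • (b - q)) y ≤ envelopeTerm M q y := hmax hmem
    simp only [envelopeTerm, Prod.fst_add, Prod.smul_fst, Prod.fst_sub,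
      Prod.snd_add, Prod.smul_snd, Prod.snd_sub, smul_eq_mul] at h
    rw [inner_add_left, real_inner_smul_left, norm_add_sq_real, real_inner_smul_right,
      norm_smul, mul_pow, Real.norm_eq_abs, sq_abs] at h
    have h2 : t * K ≤ t * (t * (‖b.1 - q.1‖ ^ 2 / (2 * M))) := by
      have e : (‖q.1‖ ^ 2 + 2 * (t * inner ℝ q.1 (b.1 - q.1)) + t ^ 2 * ‖b.1 - q.1‖ ^ 2) / (2 * M)
          = ‖q.1‖ ^ 2 / (2 * M) + t * (inner ℝ q.1 (b.1 - q.1) / M)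
            + t * (t * (‖b.1 - q.1‖ ^ 2 / (2 * M))) := by
        field_simp
      rw [hK]
      linarith
    exact le_of_mul_le_mul_left h2 ht
  by_contra! hpos
  set B : ℝ := ‖b.1 - q.1‖ ^ 2 / (2 * M) with hB
  have hB0 : 0 ≤ B := by positivity
  have h1 := hseg (min 1 (K / (2 * (B + 1)))) (by positivity) (min_le_left _ _)
  have h2 : min 1 (K / (2 * (B + 1))) * B ≤ K / (2 * (B + 1)) * B := by
    gcongr
    exact min_le_right _ _
  have h3 : K / (2 * (B + 1)) * B < K := by
    rw [div_mul_eq_mul_div, div_lt_iff₀ (by positivity)]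
    nlinarith
  linarith

/-- The descent inequality for a single term; the slack is a multiple of
`‖b.1 - q.1 - M • (z - y)‖²`. -/
lemma IsActive.envelopeTerm_le (hM : 0 < M) (h : IsActive M C y q) {b : E × ℝ} (hb : b ∈ C)
    (z : E) : envelopeTerm M b z ≤
      envelopeTerm M q y + inner ℝ q.1 (z - y) + M / 2 * ‖z - y‖ ^ 2 := by
  have h1 := h.2 b hb
  obtain ⟨d, rfl⟩ : ∃ d, z = y + d := ⟨z - y, by abel⟩
  have h2 : 0 ≤ ‖b.1 - q.1 - M • d‖ ^ 2 / (2 * M) := by positivity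
  rw [norm_sub_sq_real, norm_sub_sq_real, inner_sub_left, real_inner_smul_right,
    real_inner_smul_right, norm_smul, mul_pow, Real.norm_eq_abs, sq_abs] at h2
  have e : (‖b.1‖ ^ 2 - 2 * inner ℝ b.1 q.1 + ‖q.1‖ ^ 2
      - 2 * (M * inner ℝ b.1 d - M * inner ℝ q.1 d) + M ^ 2 * ‖d‖ ^ 2) / (2 * M)
      = ‖b.1‖ ^ 2 / (2 * M) - M⁻¹ * inner ℝ b.1 q.1 + M⁻¹ * ‖q.1‖ ^ 2 - ‖q.1‖ ^ 2 / (2 * M)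
        - inner ℝ b.1 d + inner ℝ q.1 d + M / 2 * ‖d‖ ^ 2 := by
    field_simp
    ring
  simp only [inner_sub_right, inner_smul_right, real_inner_self_eq_norm_sq] at h1
  simp only [envelopeTerm, add_sub_cancel_left, inner_add_right]
  linarith

lemma IsActive.isGreatest (hM : 0 < M) (h : IsActive M C y q) :
    IsGreatest ((fun b => envelopeTerm M b y) '' C) (envelopeTerm M q y) := by
  refine ⟨⟨q, h.1, rfl⟩, ?_⟩
  rintro _ ⟨b, hb, rfl⟩
  simpa using h.envelopeTerm_le hM hb y

lemma IsActive.smoothedMax_eq (hM : 0 < M) (h : IsActive M C y q) :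
    smoothedMax M C y = envelopeTerm M q y :=
  (h.isGreatest hM).csSup_eq

lemma envelopeTerm_le_smoothedMax (hM : 0 < M) (hC : ∀ y, ∃ q, IsActive M C y q) {b : E × ℝ}
    (hb : b ∈ C) (y : E) : envelopeTerm M b y ≤ smoothedMax M C y := by
  obtain ⟨q, hq⟩ := hC y
  exact le_csSup (hq.isGreatest hM).bddAbove ⟨b, hb, rfl⟩

lemma IsActive.smoothedMax_le (hM : 0 < M) (hC : ∀ y, ∃ q, IsActive M C y q)
    (h : IsActive M C y q) (z : E) :
    smoothedMax M C z ≤ smoothedMax M C y + inner ℝ q.1 (z - y) + M / 2 * ‖z - y‖ ^ 2 := by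
  obtain ⟨r, hr⟩ := hC z
  rw [hr.smoothedMax_eq hM, h.smoothedMax_eq hM]
  exact h.envelopeTerm_le hM hr.1 z

lemma IsActive.le_smoothedMax (hM : 0 < M) (hC : ∀ y, ∃ q, IsActive M C y q)
    (h : IsActive M C y q) (z : E) :
    smoothedMax M C y + inner ℝ q.1 (z - y) ≤ smoothedMax M C z := by
  have h1 := envelopeTerm_le_smoothedMax hM hC h.1 z
  rw [h.smoothedMax_eq hM]
  simp only [envelopeTerm, inner_sub_right] at h1 ⊢
  linarith

/-- Cocoercivity of the gradient of the smoothed maximum. -/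
lemma IsActive.cocoercive (hM : 0 < M) {r : E × ℝ} (hq : IsActive M C y q)
    (hr : IsActive M C z r) : ‖q.1 - r.1‖ ^ 2 ≤ M * inner ℝ (q.1 - r.1) (y - z) := by
  have h1 := hq.2 r hr.1
  have h2 := hr.2 q hq.1
  simp only [inner_sub_right, inner_smul_right, real_inner_self_eq_norm_sq] at h1 h2
  rw [norm_sub_sq_real]
  simp only [inner_sub_right, inner_sub_left]
  rw [real_inner_comm r.1 q.1] at *
  have h3 : M⁻¹ * (‖q.1‖ ^ 2 - 2 * inner ℝ r.1 q.1 + ‖r.1‖ ^ 2) ≤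
      inner ℝ q.1 y - inner ℝ r.1 y - (inner ℝ q.1 z - inner ℝ r.1 z) := by linarith
  rwa [inv_mul_le_iff₀ hM] at h3

lemma convexOn_smoothedMax (hM : 0 < M) (hC : ∀ y, ∃ q, IsActive M C y q) :
    ConvexOn ℝ Set.univ (smoothedMax M C) := by
  refine ⟨convex_univ, fun x _ z _ a b ha hb hab => ?_⟩
  obtain ⟨q, hq⟩ := hC (a • x + b • z)
  have h1 := mul_le_mul_of_nonneg_left (envelopeTerm_le_smoothedMax hM hC hq.1 x) ha
  have h2 := mul_le_mul_of_nonneg_left (envelopeTerm_le_smoothedMax hM hC hq.1 z) hb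
  rw [hq.smoothedMax_eq hM]
  simp only [envelopeTerm, inner_add_right, inner_smul_right, smul_eq_mul] at h1 h2 ⊢
  have : b = 1 - a := by linarith
  subst this
  linarith

lemma strongConvexOn_smoothedFn (hM : 0 < M) (hC : ∀ y, ∃ q, IsActive M C y q) :
    StrongConvexOn Set.univ μ (smoothedFn μ M C) := by
  rw [strongConvexOn_iff_convex]
  simpa [smoothedFn] using convexOn_smoothedMax hM hC

/-- Two-sided quadratic bounds determine the gradient. -/
lemma hasGradientAt_of_quadratic_bound [CompleteSpace E] {f : E → ℝ} {g x : E} {K : ℝ}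
    (h : ∀ z, |f z - f x - inner ℝ g (z - x)| ≤ K * ‖z - x‖ ^ 2) : HasGradientAt f g x := by
  rw [hasGradientAt_iff_isLittleO]
  refine Asymptotics.IsBigO.trans_isLittleO (g := fun z => ‖z - x‖ ^ 2) ?_
    (Asymptotics.isLittleO_pow_sub_sub x one_lt_two)
  refine Asymptotics.IsBigO.of_bound K (Filter.Eventually.of_forall fun z => ?_)
  simpa using h z

lemma IsActive.hasGradientAt [CompleteSpace E] (hμ : 0 ≤ μ) (hM : 0 < M)
    (hC : ∀ y, ∃ q, IsActive M C y q) (h : IsActive M C y q) :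
    HasGradientAt (smoothedFn μ M C) (μ • y + q.1) y := by
  refine hasGradientAt_of_quadratic_bound (K := (μ + M) / 2) fun z => ?_
  have h1 := h.smoothedMax_le hM hC z
  have h2 := h.le_smoothedMax hM hC z
  obtain ⟨d, rfl⟩ : ∃ d, z = y + d := ⟨z - y, by abel⟩
  simp only [add_sub_cancel_left] at *
  have h3 : 0 ≤ μ / 2 * ‖d‖ ^ 2 := by positivity
  have h4 : 0 ≤ M / 2 * ‖d‖ ^ 2 := by positivity
  simp only [smoothedFn, norm_add_sq_real, inner_add_left, real_inner_smul_left]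
  rw [abs_le]
  constructor <;> linarith

lemma IsActive.oracle_eq [CompleteSpace E] (hμ : 0 ≤ μ) (hM : 0 < M)
    (hC : ∀ y, ∃ q, IsActive M C y q) (h : IsActive M C y q) :
    oracle (smoothedFn μ M C) y = (μ / 2 * ‖y‖ ^ 2 + envelopeTerm M q y, μ • y + q.1) := by
  rw [oracle, (h.hasGradientAt hμ hM hC).gradient, smoothedFn, h.smoothedMax_eq hM]

lemma isSmoothWith_smoothedFn [CompleteSpace E] (hμ : 0 ≤ μ) (hM : 0 < M)
    (hC : ∀ y, ∃ q, IsActive M C y q) : IsSmoothWith (μ + M) (smoothedFn μ M C) := by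
  have hlip : ∀ x y, ‖∇ (smoothedFn μ M C) x - ∇ (smoothedFn μ M C) y‖ ≤
      (μ + M) * ‖x - y‖ := by
    intro x y
    obtain ⟨q, hq⟩ := hC x
    obtain ⟨r, hr⟩ := hC y
    rw [(hq.hasGradientAt hμ hM hC).gradient, (hr.hasGradientAt hμ hM hC).gradient]
    have hco := hq.cocoercive hM hr
    have e : μ • x + q.1 - (μ • y + r.1) = μ • (x - y) + (q.1 - r.1) := by
      rw [smul_sub]; abel
    rw [e]
    set d := x - y
    set s := q.1 - r.1
    have hsd : inner ℝ s d ≤ ‖s‖ * ‖d‖ := real_inner_le_norm s d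
    have hs : ‖s‖ ≤ M * ‖d‖ := by
      rcases (norm_nonneg s).eq_or_lt with h0 | h0
      · rw [← h0]; positivity
      · have : ‖s‖ * ‖s‖ ≤ ‖s‖ * (M * ‖d‖) := by nlinarith
        exact le_of_mul_le_mul_left this h0
    calc ‖μ • d + s‖ ≤ ‖μ • d‖ + ‖s‖ := norm_add_le _ _
      _ ≤ μ * ‖d‖ + M * ‖d‖ := by
        rw [norm_smul, Real.norm_eq_abs, abs_of_nonneg hμ]
        linarith
      _ = (μ + M) * ‖d‖ := by ring
  refine ⟨?_, hlip⟩
  rw [contDiff_one_iff_hasFDerivAt]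
  refine ⟨fun x => InnerProductSpace.toDual ℝ E (∇ (smoothedFn μ M C) x), ?_, fun x => ?_⟩
  · have hlip' : LipschitzWith ⟨μ + M, by positivity⟩ (∇ (smoothedFn μ M C)) :=
      LipschitzWith.of_dist_le_mul fun x y => by
        rw [dist_eq_norm, dist_eq_norm]
        exact hlip x y
    exact (InnerProductSpace.toDual ℝ E).continuous.comp hlip'.continuous
  · obtain ⟨q, hq⟩ := hC x
    have hg := hq.hasGradientAt hμ hM hC
    simpa only [hg.gradient] using hg.hasFDerivAt

end SmoothedMaximum

/-! ### The hard function and its zero-chain property -/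

section HardFunction

variable {E : Type} [NormedAddCommGroup E] [InnerProductSpace ℝ E]

/-- The vectors `v 0, …, v (n - 1)` are orthonormal. Infinite sequences of which only an initial
segment matters make it easy to extend a family by one vector. -/
def OrthonormalBelow (n : ℕ) (v : ℕ → E) : Prop :=
  ∀ i < n, ∀ j < n, inner ℝ (v i) (v j) = if i = j then (1 : ℝ) else 0

/-- The conditions on the parameters of the construction, where `κ` is the inverse condition
number `μ / L`. They are imposed on all indices, with `γ (N + 1) = 0`: the piece with index `N + 1`
is the one that is active at the minimizer. -/
structure Admissible (N : ℕ) (κ : ℝ) (γ δ : ℕ → ℝ) : Prop where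
  nonneg : ∀ i, 0 ≤ κ * δ i
  le_gamma : ∀ i, κ * δ i ≤ γ i
  le_delta : ∀ i, γ i ≤ δ i
  step : ∀ i, γ (i + 1) * δ (i + 1) ≤ -((γ i - δ i) * (γ i - κ * δ i))
  gamma_end : γ (N + 1) = 0

/-- Slope of the `i`-th affine piece. -/
noncomputable def slope (L κ : ℝ) (γ δ : ℕ → ℝ) (v : ℕ → E) (i : ℕ) : E :=
  L • (γ i • v i + κ • ∑ t ∈ Finset.range i, δ t • v t)

/-- Constant term of the `i`-th affine piece. The last summand does not depend on `i`; it makes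
the minimal value of the hard function `0`. -/
noncomputable def intercept (N : ℕ) (L κ : ℝ) (γ δ : ℕ → ℝ) (i : ℕ) : ℝ :=
  L / (1 - κ) * (γ i * δ i + κ * ∑ t ∈ Finset.range i, δ t ^ 2
    - κ / 2 * ∑ t ∈ Finset.range (N + 1), δ t ^ 2)

/-- Convex hull of the affine pieces with indices `0, …, k`. -/
noncomputable def pieces (N : ℕ) (L κ : ℝ) (γ δ : ℕ → ℝ) (v : ℕ → E) (k : ℕ) : Set (E × ℝ) :=
  convexHull ℝ ((fun i => (slope L κ γ δ v i, intercept N L κ γ δ i)) '' Set.Iic k)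

/-- The hard function built from the pieces `0, …, k`. The full function has `k = N + 1`; smaller
values of `k` give truncations that do not depend on the later directions. -/
noncomputable def hardFn (N : ℕ) (L κ : ℝ) (γ δ : ℕ → ℝ) (v : ℕ → E) (k : ℕ) : E → ℝ :=
  smoothedFn (κ * L) (L * (1 - κ)) (pieces N L κ γ δ v k)

/-- A minimizer of the hard function; the only one if `κ > 0`. -/
noncomputable def hardMin (N : ℕ) (δ : ℕ → ℝ) (v : ℕ → E) : E :=
  -∑ t ∈ Finset.range (N + 1), δ t • v t

variable {N : ℕ} {L κ : ℝ} {γ δ : ℕ → ℝ} {v w : ℕ → E} {k : ℕ}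

lemma Admissible.gamma_nonneg (h : Admissible N κ γ δ) (i : ℕ) : 0 ≤ γ i :=
  (h.nonneg i).trans (h.le_gamma i)

/-- The recursion telescopes: the constant terms drop fast enough from index `k` on. -/
lemma Admissible.telescope (h : Admissible N κ γ δ) {k j : ℕ} (hkj : k + 1 ≤ j) :
    γ j * δ j + κ * ∑ t ∈ Finset.range j, δ t ^ 2 ≤
      (1 + κ) * (γ k * δ k) - γ k ^ 2 + κ * ∑ t ∈ Finset.range k, δ t ^ 2 := by
  induction j, hkj using Nat.le_induction with
  | base =>
    rw [Finset.sum_range_succ]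
    linarith [h.step k]
  | succ j hj ih =>
    rw [Finset.sum_range_succ]
    have h1 := h.step j
    have h2 : 0 ≤ γ j * (γ j - κ * δ j) :=
      mul_nonneg (h.gamma_nonneg j) (sub_nonneg.2 (h.le_gamma j))
    linarith

lemma OrthonormalBelow.inner_sum {n m j : ℕ} (hv : OrthonormalBelow n v) (hm : m ≤ n) (hj : j < n)
    (a : ℕ → ℝ) : inner ℝ (v j) (∑ t ∈ Finset.range m, a t • v t) = if j < m then a j else 0 := by
  rw [_root_.inner_sum]
  have : ∀ t ∈ Finset.range m, inner ℝ (v j) (a t • v t) = if j = t then a t else 0 := by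
    intro t ht
    rw [real_inner_smul_right, hv j hj t (by simp at ht; omega)]
    simp
  rw [Finset.sum_congr rfl this]
  simp

lemma OrthonormalBelow.norm_sum_sq {n m : ℕ} (hv : OrthonormalBelow n v) (hm : m ≤ n)
    (a : ℕ → ℝ) : ‖∑ t ∈ Finset.range m, a t • v t‖ ^ 2 = ∑ t ∈ Finset.range m, a t ^ 2 := by
  rw [← real_inner_self_eq_norm_sq, sum_inner]
  refine Finset.sum_congr rfl fun t ht => ?_
  have ht' := Finset.mem_range.1 ht
  rw [real_inner_smul_left, hv.inner_sum hm (by omega), if_pos ht']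
  ring

lemma inner_slope (i : ℕ) (x : E) : inner ℝ (slope L κ γ δ v i) x =
    L * (γ i * inner ℝ (v i) x + κ * ∑ t ∈ Finset.range i, δ t * inner ℝ (v t) x) := by
  simp only [slope, real_inner_smul_left, inner_add_left, sum_inner]

lemma piece_mem {i : ℕ} (hi : i ≤ k) :
    (slope L κ γ δ v i, intercept N L κ γ δ i) ∈ pieces N L κ γ δ v k :=
  subset_convexHull ℝ _ ⟨i, hi, rfl⟩

/-- Affine inequalities over the pieces need to be checked only at the vertices. -/
lemma inner_add_mul_le_of_mem_pieces {x : E} {r m : ℝ}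
    (h : ∀ i ≤ k, inner ℝ (slope L κ γ δ v i) x + r * intercept N L κ γ δ i ≤ m) {b : E × ℝ}
    (hb : b ∈ pieces N L κ γ δ v k) : inner ℝ b.1 x + r * b.2 ≤ m := by
  have hconv : Convex ℝ {b : E × ℝ | inner ℝ b.1 x + r * b.2 ≤ m} := by
    refine convex_halfSpace_le ⟨fun a b => ?_, fun c a => ?_⟩ m
    · simp only [Prod.fst_add, Prod.snd_add, inner_add_left]
      ring
    · simp only [Prod.smul_fst, Prod.smul_snd, real_inner_smul_left, smul_eq_mul]
      ring
  refine convexHull_min ?_ hconv hb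
  rintro _ ⟨i, hi, rfl⟩
  exact h i hi

lemma exists_isActive_pieces (hM : 0 < L * (1 - κ)) (v : ℕ → E) (k : ℕ) (y : E) :
    ∃ q, IsActive (L * (1 - κ)) (pieces N L κ γ δ v k) y q := by
  have hfin := (Set.finite_Iic k).image
    (fun i => (slope L κ γ δ v i, intercept N L κ γ δ i))
  have hcomp : IsCompact (pieces N L κ γ δ v k) := hfin.isCompact_convexHull ℝ
  exact exists_isActive hM hcomp (convex_convexHull ℝ _) ⟨_, piece_mem k.zero_le⟩ y

lemma pieces_congr (h : ∀ i ≤ k, v i = w i) :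
    pieces N L κ γ δ v k = pieces N L κ γ δ w k := by
  unfold pieces
  congr 1
  refine Set.image_congr fun i hi => ?_
  have hi' : i ≤ k := hi
  have : slope L κ γ δ v i = slope L κ γ δ w i := by
    unfold slope
    rw [h i hi', Finset.sum_congr rfl fun t ht => ?_]
    rw [h t (by simp at ht; omega)]
  rw [this]

/-- Zero-chain property: at a point orthogonal to `v k, …, v N`, the active piece of the truncation
to the indices `≤ k` stays active in the full hard function. -/
lemma IsActive.pieces_extend (hL : 0 < L) (hκ : κ < 1) (ha : Admissible N κ γ δ)
    (hv : OrthonormalBelow (N + 1) v) (hk : k ≤ N) {y : E}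
    (hy : ∀ j, k ≤ j → j ≤ N → inner ℝ (v j) y = 0) {q : E × ℝ}
    (hq : IsActive (L * (1 - κ)) (pieces N L κ γ δ v k) y q) :
    IsActive (L * (1 - κ)) (pieces N L κ γ δ v (N + 1)) y q := by
  have hκ' : 0 < 1 - κ := by linarith
  have hmono : pieces N L κ γ δ v k ⊆ pieces N L κ γ δ v (N + 1) :=
    convexHull_mono (Set.image_mono (Set.Iic_subset_Iic.2 (by omega)))
  have hslope : ∀ j ≤ N, ∀ i ≤ k, inner ℝ (slope L κ γ δ v i) (v j) =
      L * (γ i * (if i = j then 1 else 0) + κ * if j < i then δ j else 0) := by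
    intro j hj i hi
    rw [slope, real_inner_smul_left, inner_add_left, real_inner_smul_left, real_inner_smul_left,
      hv i (by omega) j (by omega), real_inner_comm, hv.inner_sum (by omega) (by omega)]
  have hlater : ∀ j, k < j → j ≤ N → inner ℝ q.1 (v j) = 0 := by
    intro j hkj hj
    apply le_antisymm
    · have := inner_add_mul_le_of_mem_pieces (x := v j) (r := 0) (m := 0) (fun i hi => ?_) hq.1
      · simpa using this
      · rw [hslope j hj i hi, if_neg (by omega), if_neg (by omega)]
        simp
    · have := inner_add_mul_le_of_mem_pieces (x := -v j) (r := 0) (m := 0) (fun i hi => ?_) hq.1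
      · simpa using this
      · rw [inner_neg_right, hslope j hj i hi, if_neg (by omega), if_neg (by omega)]
        simp
  have hlast : inner ℝ q.1 (v k) ≤ L * γ k := by
    have := inner_add_mul_le_of_mem_pieces (x := v k) (r := 0) (m := L * γ k)
      (fun i hi => ?_) hq.1
    · simpa using this
    · rw [hslope k hk i hi, if_neg (show ¬ k < i by omega)]
      split_ifs with h
      · simp [h]
      · simpa using mul_nonneg hL.le (ha.gamma_nonneg k)
  refine ⟨hmono hq.1, fun b hb => ?_⟩
  set x := y - (L * (1 - κ))⁻¹ • q.1 with hx
  have hxlater : ∀ j, k < j → j ≤ N → inner ℝ (v j) x = 0 := by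
    intro j hkj hj
    rw [hx, inner_sub_right, real_inner_smul_right, hy j hkj.le hj, real_inner_comm,
      hlater j hkj hj]
    simp
  have hxlast : -(γ k / (1 - κ)) ≤ inner ℝ (v k) x := by
    rw [hx, inner_sub_right, real_inner_smul_right, hy k le_rfl hk, real_inner_comm]
    have h1 : (L * (1 - κ))⁻¹ * inner ℝ q.1 (v k) ≤ (L * (1 - κ))⁻¹ * (L * γ k) := by gcongr
    have h2 : (L * (1 - κ))⁻¹ * (L * γ k) = γ k / (1 - κ) := by field_simp
    linarith
  suffices hvert : ∀ i ≤ N + 1, inner ℝ (slope L κ γ δ v i) x + 1 * intercept N L κ γ δ i ≤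
      inner ℝ q.1 x + q.2 by
    simpa using inner_add_mul_le_of_mem_pieces hvert hb
  intro i hi
  rw [one_mul]
  rcases le_or_gt i k with hik | hik
  · exact hq.2 _ (piece_mem hik)
  -- A later piece lies below the `k`-th one at the proximal point.
  refine le_trans ?_ (hq.2 _ (piece_mem le_rfl))
  rw [inner_slope, inner_slope, intercept, intercept]
  have hsum : ∑ t ∈ Finset.range i, δ t * inner ℝ (v t) x =
      ∑ t ∈ Finset.range (k + 1), δ t * inner ℝ (v t) x := by
    symm
    apply Finset.sum_subset
    · exact Finset.range_subset_range.2 (by omega)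
    · intro t ht ht'
      simp only [Finset.mem_range] at ht ht'
      rw [hxlater t (by omega) (by omega), mul_zero]
  have hi0 : γ i * inner ℝ (v i) x = 0 := by
    rcases Nat.lt_or_ge N i with h | h
    · have : i = N + 1 := by omega
      rw [this, ha.gamma_end, zero_mul]
    · rw [hxlater i hik h, mul_zero]
  rw [hsum, hi0, Finset.sum_range_succ]
  have h1 := ha.telescope (Nat.succ_le_of_lt hik)
  have h2 : (γ k - κ * δ k) * -(γ k / (1 - κ)) ≤ (γ k - κ * δ k) * inner ℝ (v k) x :=
    mul_le_mul_of_nonneg_left hxlast (sub_nonneg.2 (ha.le_gamma k))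
  have h3 := mul_le_mul_of_nonneg_left h2 hL.le
  have h4 := mul_le_mul_of_nonneg_left h1 (div_pos hL hκ').le
  have e : L * ((γ k - κ * δ k) * -(γ k / (1 - κ))) =
      L / (1 - κ) * (-(γ k ^ 2) + κ * (γ k * δ k)) := by ring
  linarith

/-- The oracle answer at a point orthogonal to `v k, …, v N` is that of the truncation. -/
lemma oracle_hardFn_eq [CompleteSpace E] (hL : 0 < L) (hκ0 : 0 ≤ κ) (hκ : κ < 1)
    (ha : Admissible N κ γ δ) (hv : OrthonormalBelow (N + 1) v) (hk : k ≤ N) {y : E}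
    (hy : ∀ j, k ≤ j → j ≤ N → inner ℝ (v j) y = 0) :
    oracle (hardFn N L κ γ δ v (N + 1)) y = oracle (hardFn N L κ γ δ v k) y := by
  have hM : 0 < L * (1 - κ) := mul_pos hL (by linarith)
  have hμ : 0 ≤ κ * L := by positivity
  obtain ⟨q, hq⟩ := exists_isActive_pieces (N := N) (γ := γ) (δ := δ) hM v k y
  rw [hardFn, hardFn, hq.oracle_eq hμ hM (exists_isActive_pieces hM v k),
    (hq.pieces_extend hL hκ ha hv hk hy).oracle_eq hμ hM (exists_isActive_pieces hM v (N + 1))]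

lemma norm_hardMin_sq (hv : OrthonormalBelow (N + 1) v) :
    ‖hardMin N δ v‖ ^ 2 = ∑ t ∈ Finset.range (N + 1), δ t ^ 2 := by
  rw [hardMin, norm_neg, hv.norm_sum_sq le_rfl]

lemma slope_end (ha : Admissible N κ γ δ) :
    slope L κ γ δ v (N + 1) = -(L * κ) • hardMin N δ v := by
  rw [slope, ha.gamma_end, hardMin, zero_smul, zero_add, smul_smul, neg_smul, smul_neg, neg_neg]

lemma hardFn_lower (hM : 0 < L * (1 - κ)) {i : ℕ} (hi : i ≤ k) (y : E) :
    κ * L / 2 * ‖y‖ ^ 2 +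
      envelopeTerm (L * (1 - κ)) (slope L κ γ δ v i, intercept N L κ γ δ i) y ≤
      hardFn N L κ γ δ v k y := by
  have := envelopeTerm_le_smoothedMax hM
    (exists_isActive_pieces (N := N) (γ := γ) (δ := δ) hM v k) (piece_mem hi) y
  rw [hardFn, smoothedFn]
  linarith

/-- The contribution of the piece `N + 1` is the quadratic centred at the minimizer. -/
lemma envelopeTerm_end (hL : 0 < L) (hκ : κ < 1) (ha : Admissible N κ γ δ)
    (hv : OrthonormalBelow (N + 1) v) (y : E) :
    κ * L / 2 * ‖y‖ ^ 2 + envelopeTerm (L * (1 - κ))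
      (slope L κ γ δ v (N + 1), intercept N L κ γ δ (N + 1)) y =
      κ * L / 2 * ‖y - hardMin N δ v‖ ^ 2 := by
  have hκ' : 1 - κ ≠ 0 := by linarith
  rw [envelopeTerm, slope_end ha, intercept, ha.gamma_end, ← norm_hardMin_sq hv, norm_sub_sq_real,
    real_inner_smul_left, norm_smul, mul_pow, Real.norm_eq_abs, sq_abs,
    real_inner_comm y (hardMin N δ v)]
  field_simp
  ring

lemma hardFn_ge (hL : 0 < L) (hκ : κ < 1) (ha : Admissible N κ γ δ)
    (hv : OrthonormalBelow (N + 1) v) (y : E) :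
    κ * L / 2 * ‖y - hardMin N δ v‖ ^ 2 ≤ hardFn N L κ γ δ v (N + 1) y := by
  rw [← envelopeTerm_end hL hκ ha hv]
  exact hardFn_lower (mul_pos hL (by linarith)) le_rfl y

/-- The affine pieces all have the same value at the proximal point of the minimizer, which is
`(1 - κ)⁻¹ • hardMin N δ v`. -/
lemma isActive_hardMin (hL : 0 < L) (hκ : κ < 1) (ha : Admissible N κ γ δ)
    (hv : OrthonormalBelow (N + 1) v) :
    IsActive (L * (1 - κ)) (pieces N L κ γ δ v (N + 1)) (hardMin N δ v)
      (slope L κ γ δ v (N + 1), intercept N L κ γ δ (N + 1)) := by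
  have hκ' : 1 - κ ≠ 0 := by linarith
  refine ⟨piece_mem le_rfl, fun b hb => ?_⟩
  have hx : hardMin N δ v - (L * (1 - κ))⁻¹ • slope L κ γ δ v (N + 1) =
      (1 - κ)⁻¹ • hardMin N δ v := by
    rw [slope_end ha, smul_smul, ← one_smul ℝ (hardMin N δ v), smul_smul, smul_smul, ← sub_smul]
    congr 1
    field_simp
    ring
  rw [hx]
  have hval : ∀ i ≤ N + 1, inner ℝ (slope L κ γ δ v i) ((1 - κ)⁻¹ • hardMin N δ v) +
      intercept N L κ γ δ i =
      -(L / (1 - κ) * (κ / 2 * ∑ t ∈ Finset.range (N + 1), δ t ^ 2)) := by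
    intro i hi
    have hin : ∀ t ≤ N, inner ℝ (v t) ((1 - κ)⁻¹ • hardMin N δ v) = -((1 - κ)⁻¹ * δ t) := by
      intro t ht
      rw [real_inner_smul_right, hardMin, inner_neg_right, hv.inner_sum le_rfl (by omega),
        if_pos (by omega)]
      ring
    have hi0 : γ i * inner ℝ (v i) ((1 - κ)⁻¹ • hardMin N δ v) = -((1 - κ)⁻¹ * (γ i * δ i)) := by
      rcases Nat.lt_or_ge N i with h | h
      · have : i = N + 1 := by omega
        rw [this, ha.gamma_end]
        ring
      · rw [hin i h]
        ring
    have hsum : ∑ t ∈ Finset.range i, δ t * inner ℝ (v t) ((1 - κ)⁻¹ • hardMin N δ v) =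
        -((1 - κ)⁻¹ * ∑ t ∈ Finset.range i, δ t ^ 2) := by
      rw [Finset.mul_sum, ← Finset.sum_neg_distrib]
      refine Finset.sum_congr rfl fun t ht => ?_
      rw [hin t (by simp at ht; omega)]
      ring
    rw [inner_slope, hi0, hsum, intercept]
    ring
  rw [hval _ le_rfl]
  simpa using inner_add_mul_le_of_mem_pieces (r := 1)
    (fun i hi => by rw [one_mul]; exact (hval i hi).le) hb

lemma hardFn_hardMin (hL : 0 < L) (hκ : κ < 1) (ha : Admissible N κ γ δ)
    (hv : OrthonormalBelow (N + 1) v) :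
    hardFn N L κ γ δ v (N + 1) (hardMin N δ v) = 0 := by
  rw [hardFn, smoothedFn,
    (isActive_hardMin hL hκ ha hv).smoothedMax_eq (mul_pos hL (by linarith)),
    envelopeTerm_end hL hκ ha hv]
  simp

/-- The lower bound given by the `N`-th piece on the half-space on which `⟪v N, ·⟫ ≥ 0`. -/
lemma hardFn_ge_of_inner_nonneg (hL : 0 < L) (hκ0 : 0 ≤ κ) (hκ : κ < 1)
    (ha : Admissible N κ γ δ) (hv : OrthonormalBelow (N + 1) v) {y : E}
    (hy : 0 ≤ inner ℝ (v N) y) :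
    L / (2 * (1 - κ)) * (2 * γ N * δ N - γ N ^ 2 - κ * δ N ^ 2) ≤
      hardFn N L κ γ δ v (N + 1) y := by
  have hκ' : 1 - κ ≠ 0 := by linarith
  refine le_trans ?_ (hardFn_lower (mul_pos hL (by linarith)) N.le_succ y)
  set s := ∑ t ∈ Finset.range N, δ t • v t with hs
  set D := ∑ t ∈ Finset.range N, δ t ^ 2 with hD
  have hsD : ‖s‖ ^ 2 = D := hv.norm_sum_sq N.le_succ δ
  have hvs : inner ℝ (v N) s = 0 := by
    rw [hs, hv.inner_sum N.le_succ N.lt_succ_self, if_neg (lt_irrefl N)]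
  have hvN : ‖v N‖ ^ 2 = 1 := by
    rw [← real_inner_self_eq_norm_sq, hv N N.lt_succ_self N N.lt_succ_self, if_pos rfl]
  have hslope : slope L κ γ δ v N = L • (γ N • v N + κ • s) := rfl
  have hnorm : ‖slope L κ γ δ v N‖ ^ 2 = L ^ 2 * (γ N ^ 2 + κ ^ 2 * D) := by
    rw [hslope, norm_smul, mul_pow, norm_add_sq_real, real_inner_smul_left, real_inner_smul_right,
      hvs, norm_smul, norm_smul, mul_pow, mul_pow, hsD, hvN]
    simp only [Real.norm_eq_abs, sq_abs]
    ring
  have hin : inner ℝ (slope L κ γ δ v N) y = L * (γ N * inner ℝ (v N) y + κ * inner ℝ s y) := by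
    rw [hslope, real_inner_smul_left, inner_add_left, real_inner_smul_left, real_inner_smul_left]
  have hint : intercept N L κ γ δ N =
      L / (1 - κ) * (γ N * δ N + κ * D - κ / 2 * (D + δ N ^ 2)) := by
    rw [intercept, Finset.sum_range_succ]
  have hsq : 0 ≤ κ * L / 2 * ‖y + s‖ ^ 2 := by positivity
  have hpos : 0 ≤ L * (γ N * inner ℝ (v N) y) :=
    mul_nonneg hL.le (mul_nonneg (ha.gamma_nonneg N) hy)
  rw [norm_add_sq_real, hsD, real_inner_comm] at hsq
  rw [envelopeTerm, hnorm, hin, hint]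
  have e : L / (1 - κ) * (γ N * δ N + κ * D - κ / 2 * (D + δ N ^ 2)) -
      L ^ 2 * (γ N ^ 2 + κ ^ 2 * D) / (2 * (L * (1 - κ))) =
      L / (2 * (1 - κ)) * (2 * γ N * δ N - γ N ^ 2 - κ * δ N ^ 2) + κ * L / 2 * D := by
    field_simp
    ring
  linarith

end HardFunction

/-! ### The resisting oracle -/

section ResistingOracle

/-- A procedure with calls left may be assumed to make a call, ignoring the answer if need be. -/
lemma Procedure.exists_query {E : Type} {n : ℕ} (P : Procedure E (n + 1)) :
    ∃ (y : E) (next : ℝ × E → Procedure E n), ∀ O, P.run O = (next (O y)).run O := by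
  cases P with
  | output ξ => exact ⟨ξ, fun _ => .output ξ, fun O => by simp [Procedure.run]⟩
  | query y next => exact ⟨y, next, fun O => by simp [Procedure.run]⟩

variable {E : Type} [NormedAddCommGroup E] [InnerProductSpace ℝ E]
variable {N : ℕ} {L κ : ℝ} {γ δ : ℕ → ℝ}

lemma OrthonormalBelow.update {k : ℕ} {v : ℕ → E} (hv : OrthonormalBelow k v) {u : E}
    (hu : ‖u‖ = 1) (huv : ∀ i < k, inner ℝ u (v i) = 0) :
    OrthonormalBelow (k + 1) (Function.update v k u) := by
  intro i hi j hj
  rcases Nat.lt_succ_iff_lt_or_eq.1 hi with hi | rfl <;>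
    rcases Nat.lt_succ_iff_lt_or_eq.1 hj with hj | rfl
  · rw [Function.update_of_ne hi.ne, Function.update_of_ne hj.ne, hv i hi j hj]
  · rw [Function.update_of_ne hi.ne, Function.update_self, if_neg hi.ne, real_inner_comm, huv i hi]
  · rw [Function.update_of_ne hj.ne, Function.update_self, if_neg hj.ne', huv j hj]
  · rw [Function.update_self, if_pos rfl, real_inner_self_eq_norm_sq, hu, one_pow]

variable [FiniteDimensional ℝ E]

lemma exists_unit_orthogonal {S : Submodule ℝ E}
    (hS : Module.finrank ℝ S < Module.finrank ℝ E) :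
    ∃ u : E, ‖u‖ = 1 ∧ ∀ x ∈ S, inner ℝ u x = 0 := by
  have hne : Sᗮ ≠ ⊥ := by
    intro h
    have := S.finrank_add_finrank_orthogonal
    rw [h, finrank_bot] at this
    omega
  obtain ⟨u, hu, hu0⟩ := Submodule.exists_mem_ne_zero_of_ne_bot hne
  refine ⟨‖u‖⁻¹ • u, norm_smul_inv_norm hu0, fun x hx => ?_⟩
  rw [real_inner_smul_left, real_inner_comm, (S.mem_orthogonal u).1 hu x hx, mul_zero]

lemma finrank_sup_span_singleton_le (S : Submodule ℝ E) (x : E) :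
    Module.finrank ℝ ↥(S ⊔ Submodule.span ℝ {x}) ≤ Module.finrank ℝ S + 1 := by
  refine (Submodule.finrank_add_le_finrank_add_finrank S _).trans ?_
  gcongr
  simpa using finrank_span_le_card (R := ℝ) ({x} : Set E)

/-- The resisting oracle. When `k` directions have been fixed and `n = N - k` calls remain, the
family can be completed so that the point returned by the procedure lies in the half-space
`⟪w N, ·⟫ ≥ 0`. The subspace `S` contains the fixed directions and the points queried so far,
so `finrank S ≤ 2 * k`. -/
lemma exists_resisting (hE : Module.finrank ℝ E = 2 * N + 1) (hL : 0 < L) (hκ0 : 0 ≤ κ)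
    (hκ : κ < 1) (ha : Admissible N κ γ δ) {n : ℕ} (P : Procedure E n) {k : ℕ} (hk : k + n = N)
    {v : ℕ → E} (hv : OrthonormalBelow k v) {S : Submodule ℝ E}
    (hS : Module.finrank ℝ S ≤ 2 * k) (hvS : ∀ i < k, v i ∈ S) :
    ∃ w : ℕ → E, OrthonormalBelow (N + 1) w ∧ (∀ i < k, w i = v i) ∧
      (∀ j, k ≤ j → j ≤ N → ∀ x ∈ S, inner ℝ (w j) x = 0) ∧
      0 ≤ inner ℝ (w N) (P.run (oracle (hardFn N L κ γ δ w (N + 1)))) := by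
  induction n generalizing k v S with
  | zero =>
    obtain rfl : k = N := by omega
    cases P with
    | output ξ =>
      obtain ⟨u, hu, huS⟩ := exists_unit_orthogonal (S := S) (by omega)
      -- Replacing `u` by `-u` if necessary saves one dimension.
      obtain ⟨u, hu, huS, hξ⟩ : ∃ u : E, ‖u‖ = 1 ∧ (∀ x ∈ S, inner ℝ u x = 0) ∧
          0 ≤ inner ℝ u ξ := by
        rcases le_total 0 (inner ℝ u ξ) with h | h
        · exact ⟨u, hu, huS, h⟩
        · refine ⟨-u, by rwa [norm_neg], fun x hx => ?_, ?_⟩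
          · rw [inner_neg_left, huS x hx, neg_zero]
          · rw [inner_neg_left]
            linarith
      refine ⟨Function.update v k u, hv.update hu fun i hi => huS _ (hvS i hi),
        fun i hi => Function.update_of_ne hi.ne _ _, fun j hj hj' x hx => ?_, ?_⟩
      · obtain rfl : j = k := le_antisymm hj' hj
        rw [Function.update_self, huS x hx]
      · simpa [Procedure.run] using hξ
  | succ n ih =>
    obtain ⟨y, next, hP⟩ := P.exists_query
    have hSy := finrank_sup_span_singleton_le S y
    obtain ⟨u, hu, huS⟩ := exists_unit_orthogonal (S := S ⊔ Submodule.span ℝ {y}) (by omega)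
    set v' := Function.update v k u with hv'
    set S' := S ⊔ Submodule.span ℝ {y} ⊔ Submodule.span ℝ {u} with hS'
    have hSu : Module.finrank ℝ S' ≤ _ := finrank_sup_span_singleton_le (S ⊔ Submodule.span ℝ {y}) u
    have hSS' : S ≤ S' := le_sup_left.trans le_sup_left
    have hyS : y ∈ S ⊔ Submodule.span ℝ {y} :=
      Submodule.mem_sup_right (Submodule.mem_span_singleton_self y)
    obtain ⟨w, hw, hwv, hwS, hrun⟩ := ih (next (oracle (hardFn N L κ γ δ v' k) y)) (k := k + 1)
      (by omega) (v := v') (hv.update hu fun i hi => huS _ (Submodule.mem_sup_left (hvS i hi)))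
      (S := S') (by omega) (fun i hi => by
        rcases Nat.lt_succ_iff_lt_or_eq.1 hi with hi | rfl
        · rw [hv', Function.update_of_ne hi.ne]
          exact hSS' (hvS i hi)
        · rw [hv', Function.update_self]
          exact Submodule.mem_sup_right (Submodule.mem_span_singleton_self u))
    have hwk : w k = u := by rw [hwv k k.lt_succ_self, hv', Function.update_self]
    have hworth : ∀ j, k ≤ j → j ≤ N → ∀ x ∈ S ⊔ Submodule.span ℝ {y}, inner ℝ (w j) x = 0 := by
      intro j hj hj' x hx
      rcases hj.eq_or_lt with rfl | hj
      · rw [hwk, huS x hx]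
      · exact hwS j hj hj' x (Submodule.mem_sup_left hx)
    refine ⟨w, hw, fun i hi => ?_, fun j hj hj' x hx => hworth j hj hj' x
      (Submodule.mem_sup_left hx), ?_⟩
    · rw [hwv i (by omega), hv', Function.update_of_ne hi.ne]
    · -- The answer to the query does not depend on the directions that are still to be chosen.
      have hO : oracle (hardFn N L κ γ δ w (N + 1)) y = oracle (hardFn N L κ γ δ v' k) y := by
        rw [oracle_hardFn_eq hL hκ0 hκ ha hw (by omega) fun j hj hj' => hworth j hj hj' y hyS,
          hardFn, hardFn, pieces_congr fun i hi => hwv i (by omega)]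
      rw [hP, hO]
      exact hrun

end ResistingOracle

/-! ### Hard instances and the minimax bounds -/

section Minimax

variable {E : Type} [NormedAddCommGroup E] [InnerProductSpace ℝ E] [FiniteDimensional ℝ E]
variable {N : ℕ} {L κ R : ℝ} {γ δ : ℕ → ℝ}

/-- For every method there is an instance on which its output is bad in both senses. The error
is expressed relative to one minimizer, with the growth that makes it unique when `κ > 0`. -/
lemma exists_hard_instance (hE : Module.finrank ℝ E = 2 * N + 1) (hL : 0 < L) (hκ0 : 0 ≤ κ)
    (hκ : κ < 1) (ha : Admissible N κ γ δ) (hR : 0 ≤ R)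
    (hsum : ∑ t ∈ Finset.range (N + 1), δ t ^ 2 ≤ R ^ 2) (A : Method E N) :
    ∃ (f : E → ℝ) (xs : E), (f, 0) ∈ instances E (κ * L) L R ∧ f xs = 0 ∧
      (∀ y, κ * L / 2 * ‖y - xs‖ ^ 2 ≤ f y) ∧
      L / (2 * (1 - κ)) * (2 * γ N * δ N - γ N ^ 2 - κ * δ N ^ 2) ≤ f (A.result f 0) ∧
      δ N ≤ ‖A.result f 0 - xs‖ := by
  have hM : 0 < L * (1 - κ) := mul_pos hL (by linarith)
  have hμ : 0 ≤ κ * L := by positivity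
  obtain ⟨v, hv, -, -, hrun⟩ := exists_resisting hE hL hκ0 hκ ha (A 0) (k := 0) (by omega)
    (v := fun _ => 0) (fun i hi => absurd hi i.not_lt_zero) (S := ⊥) (by simp)
    (fun i hi => absurd hi i.not_lt_zero)
  have hact := exists_isActive_pieces (N := N) (γ := γ) (δ := δ) hM v (N + 1)
  have hzero := hardFn_hardMin hL hκ ha hv
  have hge := hardFn_ge hL hκ ha hv
  refine ⟨hardFn N L κ γ δ v (N + 1), hardMin N δ v, ⟨strongConvexOn_smoothedFn hM hact, ?_,
    hardMin N δ v, fun y => ?_, ?_⟩, hzero, hge, hardFn_ge_of_inner_nonneg hL hκ0 hκ ha hv hrun, ?_⟩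
  · have e : κ * L + L * (1 - κ) = L := by ring
    have := isSmoothWith_smoothedFn hμ hM hact
    rwa [e] at this
  · dsimp only
    rw [hzero]
    exact le_trans (by positivity) (hge y)
  · rw [sub_zero]
    refine abs_le_of_sq_le_sq' ?_ hR |>.2
    rwa [norm_hardMin_sq hv]
  · set ξ := Method.result A (hardFn N L κ γ δ v (N + 1)) 0 with hξ
    have hvN : ‖v N‖ = 1 := by
      have h1 := hv N N.lt_succ_self N N.lt_succ_self
      rw [if_pos rfl, real_inner_self_eq_norm_sq] at h1
      exact (pow_eq_one_iff_of_nonneg (norm_nonneg _) two_ne_zero).1 h1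
    have h1 : inner ℝ (v N) (ξ - hardMin N δ v) = inner ℝ (v N) ξ + δ N := by
      rw [inner_sub_right, hardMin, inner_neg_right, hv.inner_sum le_rfl N.lt_succ_self,
        if_pos N.lt_succ_self, sub_neg_eq_add]
    have h2 := real_inner_le_norm (v N) (ξ - hardMin N δ v)
    have h3 : 0 ≤ inner ℝ (v N) ξ := hrun
    rw [h1, hvN, one_mul] at h2
    linarith

/-- Only the values of `γ` and `δ` up to index `N` matter; beyond it they may be set to zero. -/
lemma admissible_truncate
    (hnonneg : ∀ i ≤ N, 0 ≤ κ * δ i ∧ κ * δ i ≤ γ i ∧ γ i ≤ δ i)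
    (hrec : ∀ i < N, γ (i + 1) * δ (i + 1) ≤ -((γ i - δ i) * (γ i - κ * δ i))) :
    Admissible N κ (fun i => if i ≤ N then γ i else 0) (fun i => if i ≤ N then δ i else 0) where
  nonneg i := by
    by_cases h : i ≤ N
    · simpa [h] using (hnonneg i h).1
    · simp [h]
  le_gamma i := by
    by_cases h : i ≤ N
    · simpa [h] using (hnonneg i h).2.1
    · simp [h]
  le_delta i := by
    by_cases h : i ≤ N
    · simpa [h] using (hnonneg i h).2.2
    · simp [h]
  step i := by
    rcases lt_trichotomy i N with h | rfl | h
    · simpa only [if_pos h.le, if_pos (Nat.succ_le_of_lt h)] using hrec i h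
    · have := hnonneg i le_rfl
      simp only [le_refl, if_true, Nat.not_succ_le_self, if_false]
      nlinarith [mul_nonneg (sub_nonneg.2 this.2.2) (sub_nonneg.2 this.2.1)]
    · simp [show ¬ i ≤ N by omega, show ¬ i + 1 ≤ N by omega]
  gamma_end := by simp

end Minimax

end OracleComplexity

theorem theoremT (N : ℕ) (L μ Rx : ℝ) (hμ : 0 ≤ μ) (hL : μ < L) (hR : 0 ≤ Rx)
    (γ δ : ℕ → ℝ)
    (hnonneg : ∀ i ≤ N, 0 ≤ μ / L * δ i ∧ μ / L * δ i ≤ γ i ∧ γ i ≤ δ i)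
    (hrec : ∀ i < N, γ (i + 1) * δ (i + 1) ≤ -((γ i - δ i) * (γ i - μ / L * δ i)))
    (hsum : ∑ t ∈ Finset.range (N + 1), δ t ^ 2 ≤ Rx ^ 2) :
    ((L ^ 2 / (2 * (L - μ)) * (2 * γ N * δ N - γ N ^ 2 - μ / L * δ N ^ 2) : ℝ) : EReal) ≤
        OracleComplexity.minimaxRisk
          (OracleComplexity.instances (EuclideanSpace ℝ (Fin (2 * N + 1))) μ L Rx) N ∧
      (0 < μ →
        ((δ N : ℝ) : EReal) ≤
          OracleComplexity.minimaxError
            (OracleComplexity.instances (EuclideanSpace ℝ (Fin (2 * N + 1))) μ L Rx) N) := by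
  have hL0 : 0 < L := hμ.trans_lt hL
  have hκ0 : 0 ≤ μ / L := by positivity
  have hκ : μ / L < 1 := (div_lt_one hL0).2 hL
  have hκL : μ / L * L = μ := div_mul_cancel₀ μ hL0.ne'
  have hsum' : ∑ t ∈ Finset.range (N + 1), (if t ≤ N then δ t else 0) ^ 2 ≤ Rx ^ 2 := by
    rw [Finset.sum_congr rfl fun t ht => by
      rw [if_pos (show t ≤ N by simp at ht; omega)]]
    exact hsum
  have hconst : L / (2 * (1 - μ / L)) = L ^ 2 / (2 * (L - μ)) := by
    have h1 : L - μ ≠ 0 := by linarith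
    have h2 : 1 - μ / L ≠ 0 := by linarith
    rw [div_eq_div_iff (by simpa using h2) (by simpa using h1)]
    field_simp
  have key := OracleComplexity.exists_hard_instance (E := EuclideanSpace ℝ (Fin (2 * N + 1))) (by simp) hL0 hκ0 hκ
    (OracleComplexity.admissible_truncate hnonneg hrec) hR hsum'
  simp only [le_refl, if_true, hκL, hconst] at key
  refine ⟨le_iInf fun A => ?_, fun hμ' => le_iInf fun A => ?_⟩
  · obtain ⟨f, xs, hmem, hxs, hge, hrisk, -⟩ := key A
    refine le_iSup₂_of_le (f, 0) hmem ?_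
    -- `f` is bounded below, so the real-valued infimum is a genuine one.
    have hinf : ⨅ y, f y = 0 := by
      have hlb : ∀ y, 0 ≤ f y := fun y => le_trans (by positivity) (hge y)
      refine le_antisymm ((ciInf_le ⟨0, ?_⟩ xs).trans hxs.le) (le_ciInf hlb)
      rintro _ ⟨y, rfl⟩
      exact hlb y
    simp only [hinf, sub_zero]
    exact_mod_cast hrisk
  · obtain ⟨f, xs, hmem, hxs, hge, -, herr⟩ := key A
    refine le_iSup₂_of_le (f, 0) hmem (le_iInf₂ fun x hx => ?_)
    obtain rfl : x = xs := by
      have h1 := (hge x).trans ((hx xs).trans hxs.le)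
      have h2 : ‖x - xs‖ ^ 2 ≤ 0 := by
        by_contra! h
        have : 0 < μ / 2 * ‖x - xs‖ ^ 2 := by positivity
        linarith
      have h3 : ‖x - xs‖ = 0 := by nlinarith [norm_nonneg (x - xs)]
      exact sub_eq_zero.1 (norm_eq_zero.1 h3)
    exact_mod_cast herr
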